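/- Consider propositional formulas built from countably infinitely many variables with the connectives $\top,\wedge,\vee,\to,\neg$ (no $\bot$). Let $\mathsf{N}$ be the logic obtained from positive logic (the $\{\top,\wedge,\vee,\to\}$-fragment of intuitionistic logic) by adding the axiom $(p\leftrightarrow q)\to(\neg p\leftrightarrow\neg q)$; let $\mathsf{NeF}$ be $\mathsf{N}$ plus $(p\wedge\neg p)\to\neg q$, let $\mathsf{CoPC}$ be $\mathsf{N}$ plus $(p\to q)\to(\neg q\to\neg p)$, and let $\mathsf{MPC}$ (minimal logic) be positive logic plus $(p\to q)\wedge(p\to\neg q)\to\neg p$. An N-logic is a set $L$ of formulas that is closed under modus ponens and uniform substitution and satisfies $\mathsf{N}\subseteq L\subseteq\mathsf{MPC}$, where each logic is identified with its set of theorems. Proposition 3.5. (1) There are exactly $2^{\aleph_0}$ N-logics $L$ with $\mathsf{NeF}\subseteq L\subseteq\mathsf{CoPC}$. (2) There are exactly $2^{\aleph_0}$ N-logics $L$ with $L\subseteq\mathsf{NeF}$. (3) There are exactly $2^{\aleph_0}$ N-logics $L$ with $\mathsf{CoPC}\subseteq L$. -/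

import Mathlib

namespace Subminimal

/-- Propositional formulas over the countably infinite set of variables `var 0, var 1, …`, with
connectives `⊤, ∧, ∨, →, ¬`; there is no `⊥` in the language. -/
inductive Form : Type where
  | var : ℕ → Form
  | top : Form
  | conj : Form → Form → Form
  | disj : Form → Form → Form
  | imp : Form → Form → Form
  | neg : Form → Form

namespace Form

/-- `φ ↔ ψ` abbreviates `(φ → ψ) ∧ (ψ → φ)`. -/
def iff (φ ψ : Form) : Form := conj (imp φ ψ) (imp ψ φ)

/-- Uniform substitution. -/
def subst (σ : ℕ → Form) : Form → Form
  | var n => σ n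
  | top => top
  | conj φ ψ => conj (subst σ φ) (subst σ ψ)
  | disj φ ψ => disj (subst σ φ) (subst σ ψ)
  | imp φ ψ => imp (subst σ φ) (subst σ ψ)
  | neg φ => neg (subst σ φ)

end Form

open Form in
/-- Theorems of the Hilbert system given by the axiom schemes of positive logic (the positive
fragment of intuitionistic logic), all substitution instances of the formulas in `Γ`, and
modus ponens. -/
inductive Provable (Γ : Set Form) : Form → Prop where
  | impK (φ ψ : Form) : Provable Γ (imp φ (imp ψ φ))
  | impS (φ ψ χ : Form) :
      Provable Γ (imp (imp φ (imp ψ χ)) (imp (imp φ ψ) (imp φ χ)))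
  | topI : Provable Γ top
  | conjL (φ ψ : Form) : Provable Γ (imp (conj φ ψ) φ)
  | conjR (φ ψ : Form) : Provable Γ (imp (conj φ ψ) ψ)
  | conjI (φ ψ : Form) : Provable Γ (imp φ (imp ψ (conj φ ψ)))
  | disjL (φ ψ : Form) : Provable Γ (imp φ (disj φ ψ))
  | disjR (φ ψ : Form) : Provable Γ (imp ψ (disj φ ψ))
  | disjE (φ ψ χ : Form) :
      Provable Γ (imp (imp φ χ) (imp (imp ψ χ) (imp (disj φ ψ) χ)))
  | ax (α : Form) (σ : ℕ → Form) : α ∈ Γ → Provable Γ (subst σ α)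
  | mp (φ ψ : Form) : Provable Γ (imp φ ψ) → Provable Γ φ → Provable Γ ψ

open Form in
/-- `(p ↔ q) → (¬p ↔ ¬q)`. -/
def axN : Form := imp (iff (var 0) (var 1)) (iff (neg (var 0)) (neg (var 1)))

open Form in
/-- `(p ∧ ¬p) → ¬q`. -/
def axNeF : Form := imp (conj (var 0) (neg (var 0))) (neg (var 1))

open Form in
/-- `(p → q) → (¬q → ¬p)`. -/
def axCoPC : Form := imp (imp (var 0) (var 1)) (imp (neg (var 1)) (neg (var 0)))

open Form in
/-- `(p → q) ∧ (p → ¬q) → ¬p`. -/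
def axMPC : Form :=
  imp (conj (imp (var 0) (var 1)) (imp (var 0) (neg (var 1)))) (neg (var 0))

/-- The basic logic `N`, as its set of theorems. -/
def logicN : Set Form := {φ | Provable {axN} φ}

/-- Negative ex falso logic: `N` extended by `(p ∧ ¬p) → ¬q`. -/
def logicNeF : Set Form := {φ | Provable {axN, axNeF} φ}

/-- Contraposition logic: `N` extended by `(p → q) → (¬q → ¬p)`. -/
def logicCoPC : Set Form := {φ | Provable {axN, axCoPC} φ}

/-- Minimal propositional logic: positive logic extended by `(p → q) ∧ (p → ¬q) → ¬p`. -/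
def logicMPC : Set Form := {φ | Provable {axMPC} φ}

/-- An N-logic, identified with its set of theorems: a set of formulas closed under modus ponens
and uniform substitution that lies between the basic logic `N` and minimal logic. -/
structure IsNLogic (L : Set Form) : Prop where
  logicN_subset : logicN ⊆ L
  subset_logicMPC : L ⊆ logicMPC
  mp : ∀ φ ψ : Form, Form.imp φ ψ ∈ L → φ ∈ L → ψ ∈ L
  subst : ∀ (σ : ℕ → Form) (φ : Form), φ ∈ L → Form.subst σ φ ∈ L

end Subminimal

/-!
Each of the three intervals contains at most `2 ^ ℵ₀` logics because there are only countably many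
formulas. For the lower bound, an independent sequence of axioms is added to the bottom of the
interval, so that distinct sets of axioms give distinct logics.

The countermodels are forks: a root below finitely many pairwise incomparable leaves. Every negated
formula is true at every leaf, and `¬φ` is true at the root iff a chosen predicate `D` holds of the
truth value of `φ` at the root and the set of leaves at which `φ` is true. Any `D` whatsoever
yields a model of `N` (`Fork.valid_axN`), since `φ` and `ψ` being equivalent at the root means that
they have the same truth value at the root and the same set of leaves. If `D` fails whenever `φ` is
true at the root, the fork is a model of `NeF`; if moreover `D` is antitone in the set of leaves,
it is a model of `CoPC`.

Let `D` express that the set of leaves is a singleton (or, for the third interval, has at most one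
element). The formula `countAxiom`, in the variables `q, p₀, …, pₖ₋₁`, says that `q` follows if all
the `¬pᵢ` hold, `q` is the disjunction of the `pᵢ`, and `¬(pᵢ ∧ pⱼ)` (or `¬(pᵢ ∨ pⱼ)`) implies `q`
for `i ≠ j`. It can only be refuted at the root of a fork with `q` true exactly at the leaves; the
premises then force the `pᵢ` to be distinct singletons that exhaust the leaves. Hence the formula
fails on the fork with `n` leaves iff `n = k` (`Fork.not_valid_countAxiom`,
`Fork.valid_countAxiom`). On the other hand, `CoPC` derives `¬(p₀ ∧ p₁)` from `¬p₀`, and `MPC`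
derives `¬(p₀ ∨ p₁)` from `¬p₀` and `¬p₁`, so that the formula is a theorem of the top of the first
and the third interval. For the second interval, `¬⊤` is added to the premises, from which `NeF`
derives every negation; correspondingly, `D` is made to hold also of all formulas true at the root.
-/

namespace Subminimal

open Form Cardinal

/-! ### Formulas -/

namespace Form

/-- An injective numbering of formulas. -/
def code : Form → ℕ
  | var n => Nat.pair 0 n
  | top => Nat.pair 1 0
  | conj φ ψ => Nat.pair 2 (Nat.pair (code φ) (code ψ))
  | disj φ ψ => Nat.pair 3 (Nat.pair (code φ) (code ψ))
  | imp φ ψ => Nat.pair 4 (Nat.pair (code φ) (code ψ))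
  | neg φ => Nat.pair 5 (code φ)

theorem code_injective : Function.Injective code := by
  intro φ
  induction φ with
  | var n => intro ψ h; cases ψ <;> simp_all [code, Nat.pair_eq_pair]
  | top => intro ψ h; cases ψ <;> simp_all [code, Nat.pair_eq_pair]
  | conj a b iha ihb =>
    intro ψ h
    cases ψ <;> simp only [code, Nat.pair_eq_pair] at h <;> try omega
    rw [iha h.2.1, ihb h.2.2]
  | disj a b iha ihb =>
    intro ψ h
    cases ψ <;> simp only [code, Nat.pair_eq_pair] at h <;> try omega
    rw [iha h.2.1, ihb h.2.2]
  | imp a b iha ihb =>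
    intro ψ h
    cases ψ <;> simp only [code, Nat.pair_eq_pair] at h <;> try omega
    rw [iha h.2.1, ihb h.2.2]
  | neg a iha =>
    intro ψ h
    cases ψ <;> simp only [code, Nat.pair_eq_pair] at h <;> try omega
    rw [iha h.2]

instance : Countable Form := code_injective.countable

theorem subst_subst (τ σ : ℕ → Form) (φ : Form) :
    subst τ (subst σ φ) = subst (fun n => subst τ (σ n)) φ := by
  induction φ <;> simp_all [subst]

theorem subst_var (φ : Form) : subst var φ = φ := by
  induction φ <;> simp_all [subst]

/-- The iterated implication `α₁ → (α₂ → ⋯ → (αₖ → φ))` for `l = [α₁, …, αₖ]`. -/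
def impList (l : List Form) (φ : Form) : Form := l.foldr imp φ

/-- The disjunction of `φ` and the members of `l`. -/
def disjList (l : List Form) (φ : Form) : Form := l.foldr disj φ

end Form

theorem mk_eq_continuum_of_injective {𝓛 : Set (Set Form)} (L : Set ℕ → Set Form)
    (hL : ∀ S, L S ∈ 𝓛) (hinj : Function.Injective L) : #𝓛 = 𝔠 := by
  apply le_antisymm
  · calc #𝓛 ≤ #(Set Form) := mk_set_le _
      _ = 2 ^ #Form := mk_set
      _ ≤ 2 ^ ℵ₀ := power_le_power_left two_ne_zero mk_le_aleph0
      _ = 𝔠 := two_power_aleph0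
  · have h : #(Set ℕ) ≤ #𝓛 :=
      mk_le_of_injective (f := fun S => (⟨L S, hL S⟩ : 𝓛))
        fun S T h => hinj (congrArg Subtype.val h)
    rwa [mk_set, mk_nat, two_power_aleph0] at h

/-! ### Derivations -/

theorem Provable.of_mem {Γ : Set Form} {α : Form} (h : α ∈ Γ) : Provable Γ α := by
  simpa only [subst_var] using Provable.ax α var h

theorem Provable.subst {Γ : Set Form} (τ : ℕ → Form) {φ : Form} (h : Provable Γ φ) :
    Provable Γ (Form.subst τ φ) := by
  induction h with
  | impK => exact .impK _ _
  | impS => exact .impS _ _ _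
  | topI => exact .topI
  | conjL => exact .conjL _ _
  | conjR => exact .conjR _ _
  | conjI => exact .conjI _ _
  | disjL => exact .disjL _ _
  | disjR => exact .disjR _ _
  | disjE => exact .disjE _ _ _
  | ax α σ hα => rw [subst_subst]; exact .ax α _ hα
  | mp φ ψ _ _ ih₁ ih₂ => exact .mp _ _ ih₁ ih₂

theorem Provable.trans {Γ Γ' : Set Form} (h : ∀ α ∈ Γ, Provable Γ' α) {φ : Form}
    (hφ : Provable Γ φ) : Provable Γ' φ := by
  induction hφ with
  | impK => exact .impK _ _
  | impS => exact .impS _ _ _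
  | topI => exact .topI
  | conjL => exact .conjL _ _
  | conjR => exact .conjR _ _
  | conjI => exact .conjI _ _
  | disjL => exact .disjL _ _
  | disjR => exact .disjR _ _
  | disjE => exact .disjE _ _ _
  | ax α σ hα => exact (h α hα).subst σ
  | mp φ ψ _ _ ih₁ ih₂ => exact .mp _ _ ih₁ ih₂

/-- Derivability in the logic axiomatized by `Γ` from the hypotheses in `C`, which, unlike the
axioms in `Γ`, may not be substituted into. -/
inductive Derives (Γ C : Set Form) : Form → Prop where
  | thm {φ : Form} : Provable Γ φ → Derives Γ C φ
  | hyp {φ : Form} : φ ∈ C → Derives Γ C φ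
  | mp {φ ψ : Form} : Derives Γ C (imp φ ψ) → Derives Γ C φ → Derives Γ C ψ

namespace Derives

variable {Γ C : Set Form} {φ ψ χ : Form}

theorem provable (h : Derives Γ ∅ φ) : Provable Γ φ := by
  induction h with
  | thm h => exact h
  | hyp h => exact h.elim
  | mp _ _ ih₁ ih₂ => exact .mp _ _ ih₁ ih₂

theorem mono {C' : Set Form} (hC : C ⊆ C') (h : Derives Γ C φ) : Derives Γ C' φ := by
  induction h with
  | thm h => exact .thm h
  | hyp h => exact .hyp (hC h)
  | mp _ _ ih₁ ih₂ => exact .mp ih₁ ih₂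

theorem weaken (h : Derives Γ C φ) : Derives Γ (insert ψ C) φ := h.mono (Set.subset_insert _ _)

theorem const (h : Derives Γ C φ) : Derives Γ C (imp ψ φ) := .mp (.thm (.impK _ _)) h

/-- The deduction theorem. -/
theorem intro (h : Derives Γ (insert ψ C) φ) : Derives Γ C (imp ψ φ) := by
  induction h with
  | thm h => exact (Derives.thm h).const
  | @hyp φ h =>
    rcases h with rfl | h
    · exact .mp (.mp (.thm (.impS _ (imp φ φ) _)) (.thm (.impK _ _))) (.thm (.impK _ _))
    · exact (Derives.hyp h).const
  | mp _ _ ih₁ ih₂ => exact .mp (.mp (.thm (.impS _ _ _)) ih₁) ih₂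

theorem andI (h₁ : Derives Γ C φ) (h₂ : Derives Γ C ψ) : Derives Γ C (conj φ ψ) :=
  .mp (.mp (.thm (.conjI _ _)) h₁) h₂

theorem andL (h : Derives Γ C (conj φ ψ)) : Derives Γ C φ := .mp (.thm (.conjL _ _)) h

theorem andR (h : Derives Γ C (conj φ ψ)) : Derives Γ C ψ := .mp (.thm (.conjR _ _)) h

theorem impList_intro {l : List Form} (h : Derives Γ (C ∪ {α | α ∈ l}) φ) :
    Derives Γ C (impList l φ) := by
  induction l generalizing C with
  | nil => exact h.mono (by simp)
  | cons a l ih =>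
    refine intro (ih (h.mono ?_))
    intro α
    simp only [Set.mem_union, Set.mem_ofPred_eq, List.mem_cons, Set.mem_insert_iff]
    tauto

theorem neg_of_axNeF (hΓ : axNeF ∈ Γ) (h₁ : Derives Γ C φ) (h₂ : Derives Γ C (neg φ)) :
    Derives Γ C (neg ψ) :=
  .mp (.thm (.ax axNeF (fun | 0 => φ | _ => ψ) hΓ)) (h₁.andI h₂)

theorem neg_of_axCoPC (hΓ : axCoPC ∈ Γ) (h₁ : Derives Γ C (imp φ ψ))
    (h₂ : Derives Γ C (neg ψ)) : Derives Γ C (neg φ) :=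
  .mp (.mp (.thm (.ax axCoPC (fun | 0 => φ | _ => ψ) hΓ)) h₁) h₂

theorem neg_of_axMPC (hΓ : axMPC ∈ Γ) (h₁ : Derives Γ C (imp φ ψ))
    (h₂ : Derives Γ C (imp φ (neg ψ))) : Derives Γ C (neg φ) :=
  .mp (.thm (.ax axMPC (fun | 0 => φ | _ => ψ) hΓ)) (h₁.andI h₂)

end Derives

theorem provable_axNeF_of_axCoPC {Γ : Set Form} (hΓ : axCoPC ∈ Γ) : Provable Γ axNeF := by
  refine (Derives.intro ?_).provable
  have h : Derives Γ (insert (conj (var 0) (neg (var 0))) ∅) _ := .hyp (Set.mem_insert _ _)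
  exact .neg_of_axCoPC hΓ h.andL.const h.andR

theorem provable_axCoPC_of_axMPC {Γ : Set Form} (hΓ : axMPC ∈ Γ) : Provable Γ axCoPC :=
  (Derives.intro <| .intro <| .neg_of_axMPC (ψ := var 1) hΓ (.hyp (by simp))
    (Derives.hyp (by simp)).const).provable

theorem provable_axN_of_axMPC {Γ : Set Form} (hΓ : axMPC ∈ Γ) : Provable Γ axN := by
  refine (Derives.intro ?_).provable
  have h : Derives Γ (insert (iff (var 0) (var 1)) ∅) (iff (var 0) (var 1)) :=
    .hyp (Set.mem_insert _ _)
  exact .andI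
    (.intro (.neg_of_axMPC hΓ h.andR.weaken (Derives.hyp (Set.mem_insert _ _)).const))
    (.intro (.neg_of_axMPC hΓ h.andL.weaken (Derives.hyp (Set.mem_insert _ _)).const))

theorem logicCoPC_subset_logicMPC : logicCoPC ⊆ logicMPC := fun _ h => h.trans <| by
  rintro α (rfl | rfl)
  · exact provable_axN_of_axMPC rfl
  · exact provable_axCoPC_of_axMPC rfl

theorem logicNeF_subset_logicCoPC : logicNeF ⊆ logicCoPC := fun _ h => h.trans <| by
  rintro α (rfl | rfl)
  · exact .of_mem (by simp)
  · exact provable_axNeF_of_axCoPC (by simp)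

theorem isNLogic_setOf_provable {Γ : Set Form} (hN : axN ∈ Γ) (h : {φ | Provable Γ φ} ⊆ logicMPC) :
    IsNLogic {φ | Provable Γ φ} where
  logicN_subset _ hφ := hφ.trans fun _ hα => .of_mem (hα ▸ hN)
  subset_logicMPC := h
  mp φ ψ := .mp φ ψ
  subst σ _ hφ := hφ.subst σ

/-! ### Fork models -/

/-- Truth at a leaf under the valuation `v`: classical, except that every negation is true. -/
def leafForces (v : ℕ → Prop) : Form → Prop
  | var n => v n
  | top => True
  | conj φ ψ => leafForces v φ ∧ leafForces v ψ
  | disj φ ψ => leafForces v φ ∨ leafForces v ψ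
  | imp φ ψ => leafForces v φ → leafForces v ψ
  | neg _ => True

namespace Fork

variable {X : Type*}

/-- The set of leaves at which a formula is true, where the variable `k` is true at the leaves in
`V k`. -/
def leaves (V : ℕ → Set X) (φ : Form) : Set X := {x | leafForces (fun k => x ∈ V k) φ}

/-- Truth at the root of the fork with set of leaves `X`, where `r k` is the truth value of the
variable `k` at the root. A negation `¬φ` is true there iff `D` holds of the truth value of `φ` at
the root and the set of leaves at which `φ` is true. -/
def rootForces (D : Prop → Set X → Prop) (r : ℕ → Prop) (V : ℕ → Set X) : Form → Prop
  | var n => r n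
  | top => True
  | conj φ ψ => rootForces D r V φ ∧ rootForces D r V ψ
  | disj φ ψ => rootForces D r V φ ∨ rootForces D r V ψ
  | imp φ ψ => (rootForces D r V φ → rootForces D r V ψ) ∧ leaves V φ ⊆ leaves V ψ
  | neg φ => D (rootForces D r V φ) (leaves V φ)

/-- Validity in the fork given by `D`: truth at the root under all persistent valuations, where
persistence means that a variable true at the root is true at all leaves. -/
def Valid (D : Prop → Set X → Prop) (φ : Form) : Prop :=
  ∀ (r : ℕ → Prop) (V : ℕ → Set X), (∀ k, r k → V k = Set.univ) → rootForces D r V φ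

variable {D : Prop → Set X → Prop} {r : ℕ → Prop} {V : ℕ → Set X} {φ ψ : Form}

theorem leaves_eq_univ (hr : ∀ k, r k → V k = Set.univ) (h : rootForces D r V φ) :
    leaves V φ = Set.univ := by
  rw [Set.eq_univ_iff_forall]
  intro x
  induction φ with
  | var n => exact Set.eq_univ_iff_forall.1 (hr n h) x
  | top => trivial
  | conj φ ψ ihφ ihψ => exact ⟨ihφ h.1, ihψ h.2⟩
  | disj φ ψ ihφ ihψ => exact h.imp ihφ ihψ
  | imp φ ψ ihφ ihψ => exact fun hx => h.2 hx
  | neg φ ih => trivial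

theorem leaves_subst (σ : ℕ → Form) (φ : Form) :
    leaves V (subst σ φ) = leaves (fun k => leaves V (σ k)) φ := by
  ext x
  induction φ with
  | var n => rfl
  | top => rfl
  | conj φ ψ ihφ ihψ => exact and_congr ihφ ihψ
  | disj φ ψ ihφ ihψ => exact or_congr ihφ ihψ
  | imp φ ψ ihφ ihψ => exact imp_congr ihφ ihψ
  | neg φ ih => rfl

theorem rootForces_subst (σ : ℕ → Form) (φ : Form) :
    rootForces D r V (subst σ φ) ↔
      rootForces D (fun k => rootForces D r V (σ k)) (fun k => leaves V (σ k)) φ := by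
  induction φ with
  | var n => rfl
  | top => rfl
  | conj φ ψ ihφ ihψ => exact and_congr ihφ ihψ
  | disj φ ψ ihφ ihψ => exact or_congr ihφ ihψ
  | imp φ ψ ihφ ihψ => simp only [subst, rootForces, ihφ, ihψ, leaves_subst]
  | neg φ ih => simp only [subst, rootForces, ih, leaves_subst]

theorem Valid.subst (h : Valid D φ) (σ : ℕ → Form) : Valid D (Form.subst σ φ) :=
  fun _ _ hr => (rootForces_subst σ φ).2 <| h _ _ fun _ hk => leaves_eq_univ hr hk

theorem Valid.of_provable {Γ : Set Form} (hΓ : ∀ α ∈ Γ, Valid D α) (h : Provable Γ φ) :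
    Valid D φ := by
  induction h with
  | ax α σ hα => exact (hΓ α hα).subst σ
  | mp φ ψ _ _ ih₁ ih₂ => exact fun r V hr => (ih₁ r V hr).1 (ih₂ r V hr)
  | topI => exact fun _ _ _ => trivial
  | impK φ ψ =>
    intro r V hr
    refine ⟨fun hφ => ⟨fun _ => hφ, fun x _ => ?_⟩, fun x hx _ => hx⟩
    rw [leaves_eq_univ hr hφ]
    trivial
  | impS φ ψ χ =>
    exact fun r V hr => ⟨fun h₁ => ⟨fun h₂ => ⟨fun h₃ => (h₁.1 h₃).1 (h₂.1 h₃),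
      fun x hx => h₁.2 hx (h₂.2 hx)⟩, fun x hx₂ hx₃ => h₁.2 hx₃ (hx₂ hx₃)⟩,
      fun x hx₁ hx₂ hx₃ => hx₁ hx₃ (hx₂ hx₃)⟩
  | conjL φ ψ => exact fun r V hr => ⟨fun h => h.1, fun x hx => hx.1⟩
  | conjR φ ψ => exact fun r V hr => ⟨fun h => h.2, fun x hx => hx.2⟩
  | conjI φ ψ =>
    intro r V hr
    refine ⟨fun hφ => ⟨fun hψ => ⟨hφ, hψ⟩, fun x hx => ⟨?_, hx⟩⟩, fun x hx hx' => ⟨hx, hx'⟩⟩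
    exact Set.eq_univ_iff_forall.1 (leaves_eq_univ hr hφ) x
  | disjL φ ψ => exact fun r V hr => ⟨Or.inl, fun x hx => Or.inl hx⟩
  | disjR φ ψ => exact fun r V hr => ⟨Or.inr, fun x hx => Or.inr hx⟩
  | disjE φ ψ χ =>
    exact fun r V hr => ⟨fun h₁ => ⟨fun h₂ => ⟨fun h => h.elim h₁.1 h₂.1,
      fun x hx => hx.elim (fun h => h₁.2 h) (fun h => h₂.2 h)⟩,
      fun x hx₂ hx => hx.elim (fun h => h₁.2 h) hx₂⟩,
      fun x hx₁ hx₂ hx => hx.elim hx₁ hx₂⟩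

theorem rootForces_impList (hr : ∀ k, r k → V k = Set.univ) {l : List Form} :
    rootForces D r V (impList l φ) ↔ ((∀ α ∈ l, rootForces D r V α) → rootForces D r V φ) ∧
      ∀ x, (∀ α ∈ l, x ∈ leaves V α) → x ∈ leaves V φ := by
  have hleaf (x : X) (l : List Form) :
      x ∈ leaves V (impList l φ) ↔ ((∀ α ∈ l, x ∈ leaves V α) → x ∈ leaves V φ) := by
    induction l with
    | nil => simp [impList]
    | cons a l ih => rw [List.forall_mem_cons, and_imp, ← ih]; rfl
  induction l with
  | nil =>
    simp only [impList, List.foldr_nil, List.not_mem_nil, false_imp_iff, implies_true,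
      true_imp_iff, iff_self_and]
    exact fun h x => Set.eq_univ_iff_forall.1 (leaves_eq_univ hr h) x
  | cons a l ih =>
    change (rootForces D r V a → rootForces D r V (impList l φ)) ∧
      (∀ x, x ∈ leaves V a → x ∈ leaves V (impList l φ)) ↔ _
    simp only [List.forall_mem_cons, and_imp, hleaf]
    refine (and_congr_left' (imp_congr_right fun _ => ih)).trans ?_
    refine and_congr_left fun h => imp_congr_right fun ha => and_iff_left fun x => h x ?_
    exact Set.eq_univ_iff_forall.1 (leaves_eq_univ hr ha) x

theorem mem_leaves_disjList {l : List Form} {x : X} :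
    x ∈ leaves V (disjList l φ) ↔ x ∈ leaves V φ ∨ ∃ α ∈ l, x ∈ leaves V α := by
  induction l with
  | nil => simp [disjList]
  | cons a l ih =>
    change x ∈ leaves V a ∨ x ∈ leaves V (disjList l φ) ↔ _
    simp only [ih, List.mem_cons, exists_eq_or_imp]
    tauto

theorem valid_axN : Valid D axN := by
  refine fun r V _ => ⟨fun h => ?_, fun x _ => ⟨fun _ => trivial, fun _ => trivial⟩⟩
  have h₁ : rootForces D r V (var 0) = rootForces D r V (var 1) := propext ⟨h.1.1, h.2.1⟩
  have h₂ : leaves V (var 0) = leaves V (var 1) := Set.Subset.antisymm h.1.2 h.2.2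
  have h₃ : rootForces D r V (neg (var 0)) = rootForces D r V (neg (var 1)) := by
    simp only [rootForces] at h₁ ⊢
    rw [h₁, h₂]
  exact ⟨⟨h₃.mp, fun x _ => trivial⟩, ⟨h₃.mpr, fun x _ => trivial⟩⟩

theorem valid_axNeF (hD : ∀ S, ¬ D True S) : Valid D axNeF := by
  refine fun r V _ => ⟨fun h => ?_, fun x _ => trivial⟩
  have h₂ := h.2
  rw [rootForces, eq_true h.1] at h₂
  exact absurd h₂ (hD _)

theorem valid_axCoPC (hD : ∀ S, ¬ D True S) (hanti : ∀ S T, S ⊆ T → D False T → D False S) :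
    Valid D axCoPC := by
  refine fun r V _ => ⟨fun h => ⟨fun h₁ => ?_, fun x _ => trivial⟩, fun x _ _ => trivial⟩
  have h1 : ¬ rootForces D r V (var 1) := fun hf => by
    rw [rootForces, eq_true hf] at h₁
    exact hD _ h₁
  have h0 : ¬ rootForces D r V (var 0) := fun hf => h1 (h.1 hf)
  rw [rootForces, eq_false h1] at h₁
  rw [rootForces, eq_false h0]
  exact hanti _ _ h.2 h₁

end Fork

/-! ### Axioms that count the leaves of a fork -/

/-- The premises of `countAxiom`, with `q = var 0` and `pᵢ = var (i + 1)` for `i < k`. For lack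
of an empty disjunction, the disjunction of the `pᵢ` repeats `p₀` as its last member. -/
def countPremises (op : Form → Form → Form) (k : ℕ) : List Form :=
  (List.range k).map (fun i => neg (var (i + 1))) ++
  (List.range k).map (fun i => imp (var (i + 1)) (var 0)) ++
  (List.range k).flatMap (fun i => (List.range k).flatMap fun j =>
    if i = j then [] else [imp (neg (op (var (i + 1)) (var (j + 1)))) (var 0)]) ++
  [imp (var 0) (disjList ((List.range k).map fun i => var (i + 1)) (var 1))]

/-- The formula expressing that `q` follows from the formulas in `Θ`, all `¬pᵢ`, all
`¬(pᵢ op pⱼ) → q` with `i ≠ j`, and `q ↔ p₀ ∨ ⋯ ∨ pₖ₋₁`. On suitable forks it says that the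
number of leaves is not `k`. -/
def countAxiom (Θ : List Form) (op : Form → Form → Form) (k : ℕ) : Form :=
  impList (Θ ++ countPremises op k) (var 0)

section CountPremises

variable {op : Form → Form → Form} {k : ℕ}

theorem forall_mem_countPremises {P : Form → Prop} :
    (∀ α ∈ countPremises op k, P α) ↔
      (∀ i < k, P (neg (var (i + 1)))) ∧ (∀ i < k, P (imp (var (i + 1)) (var 0))) ∧
      (∀ i < k, ∀ j < k, i ≠ j → P (imp (neg (op (var (i + 1)) (var (j + 1)))) (var 0))) ∧
      P (imp (var 0) (disjList ((List.range k).map fun i => var (i + 1)) (var 1))) := by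
  simp only [countPremises, List.forall_mem_append, List.forall_mem_map, List.mem_range,
    List.mem_flatMap, List.forall_mem_singleton, and_assoc]
  refine and_congr_right fun _ => and_congr_right fun _ => and_congr_left fun _ => ?_
  constructor
  · exact fun h i hi j hj hij => h _ ⟨i, hi, j, hj, by simp [hij]⟩
  · rintro h α ⟨i, hi, j, hj, hα⟩
    split_ifs at hα with hij
    · simp at hα
    · rw [List.mem_singleton.1 hα]
      exact h i hi j hj hij

/-- In a logic that derives `¬(p₀ op p₁)` from `Θ`, `¬p₀` and `¬p₁`, the count axioms with at
least two `pᵢ` are theorems. -/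
theorem provable_countAxiom {Γ : Set Form} {Θ : List Form}
    (h : ∀ C : Set Form, (∀ α ∈ Θ, α ∈ C) → neg (var 1) ∈ C → neg (var 2) ∈ C →
      Derives Γ C (neg (op (var 1) (var 2)))) (hk : 2 ≤ k) :
    Provable Γ (countAxiom Θ op k) := by
  refine (Derives.impList_intro ?_).provable
  obtain ⟨h₁, -, h₃, -⟩ := forall_mem_countPremises.1
    fun α (hα : α ∈ countPremises op k) =>
      (show α ∈ ∅ ∪ {α | α ∈ Θ ++ countPremises op k} by simp [hα])
  exact .mp (.hyp (h₃ 0 (by omega) 1 (by omega) zero_ne_one))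
    (h _ (fun α hα => by simp [hα]) (h₁ 0 (by omega)) (h₁ 1 (by omega)))

namespace Fork

theorem not_valid_countAxiom {D : Prop → Set (Fin k) → Prop} {Θ : List Form}
    (hΘ : ∀ r V, ∀ α ∈ Θ, rootForces D r V α) (hD : ∀ x, D False {x})
    (hop : ∀ r V i j x y, x ≠ y → ¬ r i → ¬ r j → V i = {x} → V j = {y} →
      ¬ rootForces D r V (neg (op (var i) (var j)))) :
    ¬ Valid D (countAxiom Θ op k) := by
  -- `q` is true at all leaves and `pᵢ` at the `i`-th leaf only; no variable is true at the root.
  let V : ℕ → Set (Fin k) := fun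
    | 0 => Set.univ
    | i + 1 => {x | x.val = i}
  have hV (i : ℕ) (hi : i < k) : V (i + 1) = {⟨i, hi⟩} := by
    ext x
    exact (Fin.ext_iff (a := x) (b := ⟨i, hi⟩)).symm
  intro h
  refine ((rootForces_impList (fun _ => False.elim)).1 (h (fun _ => False) V fun _ => False.elim)).1
    (List.forall_mem_append.2 ⟨hΘ _ _, forall_mem_countPremises.2 ⟨?_, ?_, ?_, ?_⟩⟩)
  · intro i hi
    change D False (V (i + 1))
    rw [hV i hi]
    exact hD _
  · exact fun i hi => ⟨id, fun x _ => Set.mem_univ x⟩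
  · refine fun i hi j hj hij => ⟨fun hneg => ?_, fun x _ => Set.mem_univ x⟩
    exact absurd hneg (hop _ V _ _ ⟨i, hi⟩ ⟨j, hj⟩ (by simpa using hij) id id (hV i hi) (hV j hj))
  · refine ⟨False.elim, fun x _ => mem_leaves_disjList.2 (Or.inr ⟨var (x + 1), ?_, ?_⟩)⟩
    · exact List.mem_map.2 ⟨x, List.mem_range.2 x.isLt, rfl⟩
    · exact (rfl : x.val = x.val)

theorem valid_countAxiom {n : ℕ} {D : Prop → Set (Fin n) → Prop} {Θ : List Form}
    (hop : ∀ r V i j, ¬ r i → ¬ r j → D False (V i) → D False (V j) →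
      ¬ rootForces D r V (neg (op (var i) (var j))) → ∃ x y, x ≠ y ∧ V i = {x} ∧ V j = {y})
    (hk : 2 ≤ k) (hkn : k ≠ n) : Valid D (countAxiom Θ op k) := by
  intro r V hr
  refine (rootForces_impList hr).2 ⟨fun h => ?_, fun x h => ?_⟩
  · obtain ⟨h₁, h₂, h₃, h₄⟩ := forall_mem_countPremises.1 (List.forall_mem_append.1 h).2
    by_contra hq
    change ¬ r 0 at hq
    have hp (i : ℕ) (hi : i < k) : ¬ r (i + 1) := fun hri => hq ((h₂ i hi).1 hri)
    have hD (i : ℕ) (hi : i < k) : D False (V (i + 1)) := by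
      have := h₁ i hi
      rwa [rootForces, rootForces, eq_false (hp i hi)] at this
    have hpair (i : ℕ) (hi : i < k) (j : ℕ) (hj : j < k) (hij : i ≠ j) :=
      hop r V _ _ (hp i hi) (hp j hj) (hD i hi) (hD j hj) fun hneg => hq ((h₃ i hi j hj hij).1 hneg)
    have hsingle (i : Fin k) : ∃ x, V (i + 1) = {x} := by
      obtain ⟨j, hj, hij⟩ : ∃ j < k, i.val ≠ j := by
        rcases eq_or_ne i.val 0 with h0 | h0
        · exact ⟨1, by omega, by omega⟩
        · exact ⟨0, by omega, h0⟩
      obtain ⟨x, -, -, hx, -⟩ := hpair i i.isLt j hj hij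
      exact ⟨x, hx⟩
    choose a ha using hsingle
    have hinj : Function.Injective a := by
      intro i j hij
      by_contra hne
      obtain ⟨x, y, hxy, hx, hy⟩ := hpair i i.isLt j j.isLt (fun h => hne (Fin.ext h))
      rw [ha, Set.singleton_eq_singleton_iff] at hx hy
      exact hxy (by rw [← hx, ← hy, hij])
    have hsurj : Function.Surjective a := by
      intro x
      -- Negations hold at leaves, so the premise `¬(p₀ op p₁) → q` makes `q` true there.
      have hx : x ∈ V 0 := (h₃ 0 (by omega) 1 (by omega) zero_ne_one).2
        (show x ∈ leaves V (neg _) from trivial)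
      obtain ⟨i, hi, hxi⟩ : ∃ i < k, x ∈ V (i + 1) := by
        rcases mem_leaves_disjList.1 (h₄.2 hx) with hx | ⟨α, hα, hx⟩
        · exact ⟨0, by omega, hx⟩
        · obtain ⟨i, hi, rfl⟩ := List.mem_map.1 hα
          exact ⟨i, List.mem_range.1 hi, hx⟩
      refine ⟨⟨i, hi⟩, ?_⟩
      rw [show V (i + 1) = _ from ha ⟨i, hi⟩] at hxi
      exact hxi.symm
    exact hkn (by simpa using Fintype.card_of_bijective ⟨hinj, hsurj⟩)
  · obtain ⟨-, -, h₃, -⟩ := forall_mem_countPremises.1 (List.forall_mem_append.1 h).2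
    exact h₃ 0 (by omega) 1 (by omega) zero_ne_one trivial

end Fork

end CountPremises

/-! ### Continuum many logics -/

/-- If the axioms in `Γ` are valid in the forks `D n`, and the count axiom with `k + 2` variables
`pᵢ` is valid in `D n` iff `k ≠ n`, then adding different sets of count axioms to `Γ` yields
different logics. -/
theorem injective_provable_union_countAxiom {Γ : Set Form} {Θ : List Form}
    {op : Form → Form → Form} (D : ∀ n : ℕ, Prop → Set (Fin n) → Prop)
    (hΓ : ∀ n, ∀ α ∈ Γ, Fork.Valid (D n) α)
    (hΘ : ∀ n r V, ∀ α ∈ Θ, Fork.rootForces (D n) r V α) (hD : ∀ n x, D n False {x})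
    (hop : ∀ n r V i j x y, x ≠ y → ¬ r i → ¬ r j → V i = {x} → V j = {y} →
      ¬ Fork.rootForces (D n) r V (neg (op (var i) (var j))))
    (hop' : ∀ n r V i j, ¬ r i → ¬ r j → D n False (V i) → D n False (V j) →
      ¬ Fork.rootForces (D n) r V (neg (op (var i) (var j))) →
        ∃ x y, x ≠ y ∧ V i = {x} ∧ V j = {y}) :
    Function.Injective fun S : Set ℕ =>
      {φ | Provable (Γ ∪ (fun k => countAxiom Θ op (k + 2)) '' S) φ} := by
  have key (S : Set ℕ) (n : ℕ) :
      Provable (Γ ∪ (fun k => countAxiom Θ op (k + 2)) '' S) (countAxiom Θ op (n + 2)) ↔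
        n ∈ S := by
    refine ⟨fun h => ?_, fun h => .of_mem (Or.inr ⟨n, h, rfl⟩)⟩
    by_contra hn
    refine Fork.not_valid_countAxiom (hΘ (n + 2)) (hD (n + 2)) (hop (n + 2))
      (Fork.Valid.of_provable ?_ h)
    rintro α (hα | ⟨k, hk, rfl⟩)
    · exact hΓ _ α hα
    · refine Fork.valid_countAxiom (hop' (n + 2)) (by omega) ?_
      have : k ≠ n := fun h => hn (h ▸ hk)
      omega
  intro S T h
  ext n
  rw [← key S, ← key T]
  exact Set.ext_iff.1 h _

theorem mk_logics_NeF_CoPC :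
    #{L : Set Form | IsNLogic L ∧ logicNeF ⊆ L ∧ L ⊆ logicCoPC} = 𝔠 := by
  have hinj := injective_provable_union_countAxiom (Γ := {axN, axNeF}) (Θ := []) (op := conj)
    (fun n r S => ¬ r ∧ ∃ x, S = {x}) ?_ ?_ ?_ ?_ ?_
  · refine mk_eq_continuum_of_injective _ (fun S => ?_) hinj
    have hsub : {φ | Provable ({axN, axNeF} ∪ (fun k => countAxiom [] conj (k + 2)) '' S) φ} ⊆
        logicCoPC := by
      refine fun φ hφ => hφ.trans ?_
      rintro α ((rfl | rfl) | ⟨k, -, rfl⟩)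
      · exact .of_mem (by simp)
      · exact provable_axNeF_of_axCoPC (by simp)
      · exact provable_countAxiom (fun C _ h₁ _ =>
          .neg_of_axCoPC (by simp) (.thm (.conjL _ _)) (.hyp h₁)) (by omega)
    exact ⟨isNLogic_setOf_provable (by simp) (hsub.trans logicCoPC_subset_logicMPC),
      fun φ hφ => hφ.trans fun α hα => .of_mem (Or.inl hα), hsub⟩
  · rintro n α (rfl | rfl)
    · exact Fork.valid_axN
    · exact Fork.valid_axNeF (by simp)
  · simp
  · simp
  · rintro n r V i j x y hxy hi hj hVi hVj ⟨-, z, hz⟩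
    have hzm : z ∈ V i ∩ V j := hz.ge rfl
    rw [hVi, hVj] at hzm
    exact hxy (hzm.1.symm.trans hzm.2)
  · rintro n r V i j hi hj ⟨-, x, hx⟩ ⟨-, y, hy⟩ h
    refine ⟨x, y, ?_, hx, hy⟩
    rintro rfl
    refine h ⟨fun h => hi h.1, x, ?_⟩
    change V i ∩ V j = _
    rw [hx, hy, Set.inter_self]

theorem mk_logics_subset_NeF : #{L : Set Form | IsNLogic L ∧ L ⊆ logicNeF} = 𝔠 := by
  have hinj := injective_provable_union_countAxiom (Γ := {axN}) (Θ := [neg top]) (op := conj)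
    (fun n r S => r ∨ ∃ x, S = {x}) ?_ ?_ ?_ ?_ ?_
  · refine mk_eq_continuum_of_injective _ (fun S => ?_) hinj
    have hsub : {φ | Provable ({axN} ∪ (fun k => countAxiom [neg top] conj (k + 2)) '' S) φ} ⊆
        logicNeF := by
      refine fun φ hφ => hφ.trans ?_
      rintro α (rfl | ⟨k, -, rfl⟩)
      · exact .of_mem (by simp)
      · exact provable_countAxiom (fun C h _ _ =>
          .neg_of_axNeF (by simp) (.thm .topI) (.hyp (h _ (by simp)))) (by omega)
    exact ⟨isNLogic_setOf_provable (by simp)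
      (hsub.trans (logicNeF_subset_logicCoPC.trans logicCoPC_subset_logicMPC)), hsub⟩
  · rintro n α rfl
    exact Fork.valid_axN
  · simp [Fork.rootForces]
  · simp
  · rintro n r V i j x y hxy hi hj hVi hVj (h | ⟨z, hz⟩)
    · exact hi h.1
    · have hzm : z ∈ V i ∩ V j := hz.ge rfl
      rw [hVi, hVj] at hzm
      exact hxy (hzm.1.symm.trans hzm.2)
  · intro n r V i j hi hj hVi hVj h
    obtain ⟨x, hx⟩ := hVi.resolve_left id
    obtain ⟨y, hy⟩ := hVj.resolve_left id
    refine ⟨x, y, ?_, hx, hy⟩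
    rintro rfl
    refine h (Or.inr ⟨x, ?_⟩)
    change V i ∩ V j = _
    rw [hx, hy, Set.inter_self]

theorem mk_logics_CoPC_subset : #{L : Set Form | IsNLogic L ∧ logicCoPC ⊆ L} = 𝔠 := by
  have hinj := injective_provable_union_countAxiom (Γ := {axN, axCoPC}) (Θ := []) (op := disj)
    (fun n r S => ¬ r ∧ S.Subsingleton) ?_ ?_ ?_ ?_ ?_
  · refine mk_eq_continuum_of_injective _ (fun S => ?_) hinj
    have hsub : {φ | Provable ({axN, axCoPC} ∪ (fun k => countAxiom [] disj (k + 2)) '' S) φ} ⊆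
        logicMPC := by
      refine fun φ hφ => hφ.trans ?_
      rintro α ((rfl | rfl) | ⟨k, -, rfl⟩)
      · exact provable_axN_of_axMPC rfl
      · exact provable_axCoPC_of_axMPC rfl
      · refine provable_countAxiom (fun C _ h₁ h₂ => ?_) (by omega)
        -- In minimal logic `¬φ` yields `φ → ¬⊤`, and `¬χ` follows from `χ → ¬⊤`.
        have key {φ : Form} (h : neg φ ∈ C) : Derives {axMPC} C (imp φ (neg top)) :=
          .intro (.neg_of_axMPC rfl (Derives.hyp (Set.mem_insert _ _)).const
            (Derives.hyp (Set.mem_insert_of_mem _ h)).const)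
        exact .neg_of_axMPC rfl (Derives.thm .topI).const
          (.mp (.mp (.thm (.disjE _ _ _)) (key h₁)) (key h₂))
    exact ⟨isNLogic_setOf_provable (by simp) hsub,
      fun φ hφ => hφ.trans fun α hα => .of_mem (Or.inl hα)⟩
  · rintro n α (rfl | rfl)
    · exact Fork.valid_axN
    · exact Fork.valid_axCoPC (by simp) fun S T hST hT => ⟨id, hT.2.anti hST⟩
  · simp
  · simp
  · rintro n r V i j x y hxy hi hj hVi hVj ⟨-, h⟩
    exact hxy (h (Or.inl (hVi.ge rfl)) (Or.inr (hVj.ge rfl)))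
  · rintro n r V i j hi hj ⟨-, hVi⟩ ⟨-, hVj⟩ h
    have h' : ¬ (V i ∪ V j).Subsingleton := fun hs => h ⟨fun h => h.elim hi hj, hs⟩
    rcases hVi.eq_empty_or_singleton with hx | ⟨x, hx⟩
    · rw [hx, Set.empty_union] at h'
      exact absurd hVj h'
    rcases hVj.eq_empty_or_singleton with hy | ⟨y, hy⟩
    · rw [hy, Set.union_empty] at h'
      exact absurd hVi h'
    refine ⟨x, y, ?_, hx, hy⟩
    rintro rfl
    rw [hx, hy, Set.union_self] at h'
    exact h' Set.subsingleton_singleton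

end Subminimal

theorem proposition3p5 :
    Cardinal.mk {L : Set Subminimal.Form |
        Subminimal.IsNLogic L ∧ Subminimal.logicNeF ⊆ L ∧ L ⊆ Subminimal.logicCoPC}
      = Cardinal.continuum ∧
    Cardinal.mk {L : Set Subminimal.Form |
        Subminimal.IsNLogic L ∧ L ⊆ Subminimal.logicNeF}
      = Cardinal.continuum ∧
    Cardinal.mk {L : Set Subminimal.Form |
        Subminimal.IsNLogic L ∧ Subminimal.logicCoPC ⊆ L}
      = Cardinal.continuum :=
  ⟨Subminimal.mk_logics_NeF_CoPC, Subminimal.mk_logics_subset_NeF,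
    Subminimal.mk_logics_CoPC_subset⟩
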